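/- Let $\mathbb{K}=\mathbb{R}$ or $\mathbb{C}$, let $\Omega$ be a non-empty set and let $(\mathcal{F},\|\cdot\|)$ be a normed space of $\mathbb{K}$-valued functions on $\Omega$ (a linear subspace of $\mathbb{K}^{\Omega}$ with a norm). Let $\tau$ be a Hausdorff locally convex topology on $\mathcal{F}$ such that $(\mathcal{F},\|\cdot\|,\tau)$ is a semi-reflexive Saks space, that is: (i) $\tau$ is coarser than the norm topology $\tau_{\|\cdot\|}$, and $\tau$ is generated by a directed system $\Gamma_\tau$ of continuous seminorms with $\|f\|=\sup_{q\in\Gamma_\tau}q(f)$ for all $f\in\mathcal{F}$; (ii) $(\mathcal{F},\gamma)$ is semi-reflexive, i.e. the evaluation map $\mathcal{F}\to((\mathcal{F},\gamma)'_b)'$ is surjective, where $(\cdot)'_b$ denotes the topological dual with the topology of uniform convergence on bounded sets and the mixed topology $\gamma$ is the finest linear topology on $\mathcal{F}$ with $\tau\le\gamma\le\tau_{\|\cdot\|}$ (where $\le$ means "coarser than") that coincides with $\tau$ on $\|\cdot\|$-bounded sets. Suppose that $\tau$ is finer than the topology of pointwise convergence on $\Omega$. An isometric Banach predual of $\mathcal{F}$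 is a pair $(Z,\varphi)$ of a Banach space $Z$ over $\mathbb{K}$ and an isometric isomorphism $\varphi\colon\mathcal{F}\to Z^{*}$ onto the dual with the dual norm. One says that $\mathcal{F}$ has a unique isometric Banach predual if it has an isometric Banach predual and for any two isometric Banach preduals $(Y,\varphi)$ and $(Z,\psi)$ of $\mathcal{F}$ there is an isometric isomorphism $Y\to Z$. Then the following assertions are equivalent. (a) $(\mathcal{F},\|\cdot\|)$ has a unique isometric Banach predual. (b) For every isometric Banach predual $(Z,\varphi)$ of $(\mathcal{F},\|\cdot\|)$ there is an isometric isomorphism $\psi\colon\mathcal{F}\to Z^{*}$ such that for every $x\in\Omega$ there is a unique $z_x\in Z$ with $f(x)=\psi(f)(z_x)$ for all $f\in\mathcal{F}$. -/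

import Mathlib

universe v

section SaksSpaces

variable (𝕜 : Type) [RCLike 𝕜] {X : Type v}

/-- `τ` is a Hausdorff locally convex topology on the normed space `X` that is coarser than the
norm topology, i.e. `(X, ‖·‖, τ)` is a pre-Saks space.  (In Mathlib's order on topologies, `t ≤ s`
means that `t` is finer than `s`.) -/
structure IsPreSaksSpace [NormedAddCommGroup X] [NormedSpace 𝕜 X] (τ : TopologicalSpace X) :
    Prop where
  t2 : @T2Space X τ
  locallyConvex : @PolynormableSpace 𝕜 X _ _ _ τ
  coarser_norm : (UniformSpace.toTopologicalSpace : TopologicalSpace X) ≤ τ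

/-- `(X, ‖·‖, τ)` is a Saks space: it is a pre-Saks space and `τ` is generated by a directed system
`Γ` of seminorms such that `‖x‖ = sup_{q ∈ Γ} q x` for every `x`. -/
structure IsSaksSpace [NormedAddCommGroup X] [NormedSpace 𝕜 X] (τ : TopologicalSpace X) : Prop
    extends IsPreSaksSpace 𝕜 τ where
  exists_seminorms : ∃ Γ : Set (Seminorm 𝕜 X), DirectedOn (· ≤ ·) Γ ∧
    @WithSeminorms 𝕜 X Γ _ _ _ (fun q => (q : Seminorm 𝕜 X)) τ ∧
    ∀ x : X, IsLUB ((fun q : Seminorm 𝕜 X => q x) '' Γ) ‖x‖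

/-- `t` is a linear (vector space) topology on `X` which lies between `τ` and the norm topology and
coincides with `τ` on norm-bounded sets. -/
structure IsMixedCandidate [NormedAddCommGroup X] [NormedSpace 𝕜 X] (τ t : TopologicalSpace X) :
    Prop where
  continuous_add : @ContinuousAdd X t _
  continuous_smul : @ContinuousSMul 𝕜 X _ _ t
  finer : t ≤ τ
  coarser_norm : (UniformSpace.toTopologicalSpace : TopologicalSpace X) ≤ t
  eq_on_bounded : ∀ B : Set X, Bornology.IsBounded B →
    TopologicalSpace.induced ((↑) : B → X) t = TopologicalSpace.induced ((↑) : B → X) τ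

/-- The mixed topology `γ(‖·‖, τ)`: the finest linear topology between `τ` and the norm topology
that coincides with `τ` on norm-bounded sets. -/
@[reducible] def mixedTopology [NormedAddCommGroup X] [NormedSpace 𝕜 X] (τ : TopologicalSpace X) :
    TopologicalSpace X :=
  sInf {t | IsMixedCandidate 𝕜 τ t}

/-- On a pre-Saks space the mixed topology is indeed the finest such topology. -/
theorem isLeast_mixedTopology [NormedAddCommGroup X] [NormedSpace 𝕜 X] (τ : TopologicalSpace X)
    (h : IsPreSaksSpace 𝕜 τ) : IsLeast {t | IsMixedCandidate 𝕜 τ t} (mixedTopology 𝕜 τ) := by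
  have hτ : IsMixedCandidate 𝕜 τ τ := by
    let _ := τ
    have hw := @PolynormableSpace.withSeminorms 𝕜 X _ _ _ τ h.locallyConvex
    exact ⟨hw.topologicalAddGroup.toContinuousAdd, hw.continuousSMul, le_rfl,
      h.coarser_norm, fun _ _ => rfl⟩
  refine ⟨⟨?_, ?_, ?_, ?_, ?_⟩, fun t ht => sInf_le ht⟩
  · exact continuousAdd_sInf fun t ht => ht.continuous_add
  · exact continuousSMul_sInf fun t ht => ht.continuous_smul
  · exact sInf_le hτ
  · exact le_sInf fun t ht => ht.coarser_norm
  · intro B hB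
    rw [mixedTopology, induced_sInf]
    apply le_antisymm
    · exact sInf_le ⟨τ, hτ, rfl⟩
    · refine le_sInf ?_
      rintro _ ⟨t, ht, rfl⟩
      exact (ht.eq_on_bounded B hB).ge

/-- A topological vector space `X` is semi-reflexive if the evaluation map `X → (X'_b)'` is
surjective, where `X'_b` is the topological dual with the topology of uniform convergence on bounded
sets (this is the topology that `StrongDual 𝕜 X` carries). -/
def IsSemireflexive (X : Type v) [AddCommGroup X] [Module 𝕜 X] [TopologicalSpace X] : Prop :=
  ∀ Φ : StrongDual 𝕜 (StrongDual 𝕜 X), ∃ x : X, ∀ f : StrongDual 𝕜 X, Φ f = f x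

/-- `(X, ‖·‖, τ)` is a semi-reflexive Saks space: a Saks space such that `X` with the mixed topology
is semi-reflexive. -/
structure IsSemireflexiveSaksSpace [NormedAddCommGroup X] [NormedSpace 𝕜 X]
    (τ : TopologicalSpace X) : Prop extends IsSaksSpace 𝕜 τ where
  semireflexive : @IsSemireflexive 𝕜 _ X _ _ (mixedTopology 𝕜 τ)

end SaksSpaces

/-- `X` has a unique isometric Banach predual: there is an isometric Banach predual `(Y, φ)`, and for
any two isometric Banach preduals `(Y, φ)` and `(Z, ψ)` there is an isometric isomorphism `Y → Z`.
The universe `v` of `X` is no restriction, since every isometric Banach predual of `X` is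
isometrically isomorphic to a closed subspace of the dual of `X`, which lives in `Type v`. -/
def HasUniqueIsometricBanachPredual (𝕜 : Type) [RCLike 𝕜] (X : Type v) [NormedAddCommGroup X]
    [NormedSpace 𝕜 X] : Prop :=
  (∃ (Y : Type v) (_ : NormedAddCommGroup Y) (_ : NormedSpace 𝕜 Y) (_ : CompleteSpace Y),
    Nonempty (X ≃ₗᵢ[𝕜] StrongDual 𝕜 Y)) ∧
  ∀ (Y : Type v) [NormedAddCommGroup Y] [NormedSpace 𝕜 Y] [CompleteSpace Y]
    (Z : Type v) [NormedAddCommGroup Z] [NormedSpace 𝕜 Z] [CompleteSpace Z]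
    (_φ : X ≃ₗᵢ[𝕜] StrongDual 𝕜 Y) (_ψ : X ≃ₗᵢ[𝕜] StrongDual 𝕜 Z), Nonempty (Y ≃ₗᵢ[𝕜] Z)

open scoped Topology

/-! The functionals continuous for the mixed topology `γ` form a norm-closed subspace `M = mixedDual
𝕜 τ` of the norm dual of `F`. Evaluation `F → M*` is isometric because the seminorms generating `τ`
have supremum the norm, and onto because `(F, γ)` is semi-reflexive; so `M` is a Banach predual, and
it contains the point evaluations, which are `τ`-continuous.

(a) ⇒ (b): every predual is isometric to `M`, and the identification `F = M*` transports along this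
isometry.

(b) ⇒ (a): `ψ` embeds `Z` isometrically into the dual of `F`, with closed range containing the point
evaluations. These separate the points of `F`, which is `Z*` via `ψ`, so by Hahn-Banach their closed
span is all of `Z`. That closed span depends only on `F`, so any two preduals are isometric. -/

/-- Hahn-Banach for seminorms: at every point some linear functional dominated by `q` attains
`q`. -/
theorem Seminorm.exists_linearMap_le_eq {𝕜 E : Type*} [RCLike 𝕜] [AddCommGroup E] [Module 𝕜 E]
    (q : Seminorm 𝕜 E) (x : E) : ∃ y : E →ₗ[𝕜] 𝕜, (∀ z, ‖y z‖ ≤ q z) ∧ y x = (q x : 𝕜) := by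
  let _ : SeminormedAddCommGroup E := q.toSeminormedAddCommGroup
  let _ : NormedSpace 𝕜 E := ⟨fun a b => (map_smul_eq_mul q a b).le⟩
  obtain ⟨g, hg, hgx⟩ := exists_dual_vector'' 𝕜 x
  refine ⟨g.toLinearMap, fun z => ?_, hgx⟩
  have h := g.le_of_opNorm_le hg z
  rw [one_mul] at h
  exact h

/-- A linear functional dominated by a continuous seminorm is continuous. -/
theorem LinearMap.continuous_of_norm_le_seminorm {𝕜 E : Type*} [RCLike 𝕜] [AddCommGroup E]
    [Module 𝕜 E] [TopologicalSpace E] [IsTopologicalAddGroup E] {q : Seminorm 𝕜 E}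
    (hq : Continuous q) (y : E →ₗ[𝕜] 𝕜) (hy : ∀ z, ‖y z‖ ≤ q z) : Continuous y := by
  refine continuous_of_continuousAt_zero y ?_
  rw [ContinuousAt, map_zero]
  refine squeeze_zero_norm hy ?_
  simpa using hq.tendsto 0

/-- A closed subspace annihilated only by the zero functional is everything. -/
theorem Submodule.eq_top_of_forall_dual_eq_zero {𝕜 E : Type*} [RCLike 𝕜] [NormedAddCommGroup E]
    [NormedSpace 𝕜 E] (S : Submodule 𝕜 E) (hS : IsClosed (S : Set E))
    (h : ∀ g : StrongDual 𝕜 E, (∀ z ∈ S, g z = 0) → g = 0) : S = ⊤ := by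
  rw [Submodule.eq_top_iff']
  intro z
  rw [← Submodule.Quotient.mk_eq_zero]
  have : IsClosed (S : Set E) := hS
  refine SeparatingDual.eq_zero_of_forall_dual_eq_zero (R := 𝕜) fun g => ?_
  have h0 := h (g.comp S.mkQL) fun w hw => by
    have : S.mkQL w = 0 := (Submodule.Quotient.mk_eq_zero S).2 hw
    simp [this]
  exact DFunLike.congr_fun h0 z

/-- Precomposition with a linear isometric isomorphism. -/
def LinearIsometryEquiv.strongDualCongr {𝕜 Y Z : Type*} [RCLike 𝕜] [NormedAddCommGroup Y]
    [NormedSpace 𝕜 Y] [NormedAddCommGroup Z] [NormedSpace 𝕜 Z] (e : Z ≃ₗᵢ[𝕜] Y) :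
    StrongDual 𝕜 Y ≃ₗᵢ[𝕜] StrongDual 𝕜 Z where
  toFun f := f.comp (e : Z →L[𝕜] Y)
  invFun f := f.comp (e.symm : Y →L[𝕜] Z)
  left_inv f := by ext; simp
  right_inv f := by ext; simp
  map_add' f g := by ext; simp
  map_smul' c f := by ext; simp
  norm_map' f := ContinuousLinearMap.opNorm_comp_linearIsometryEquiv f e

/-- The dual of a normed space with respect to the norm topology, as a normed space whose instances
do not depend on any further topology on the space. -/
def NormedDual (𝕜 F : Type*) [RCLike 𝕜] [NormedAddCommGroup F] [NormedSpace 𝕜 F] : Type _ :=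
  StrongDual 𝕜 F

namespace NormedDual

variable {𝕜 F : Type*} [RCLike 𝕜] [NormedAddCommGroup F] [NormedSpace 𝕜 F]

noncomputable instance : NormedAddCommGroup (NormedDual 𝕜 F) :=
  inferInstanceAs (NormedAddCommGroup (StrongDual 𝕜 F))

noncomputable instance : NormedSpace 𝕜 (NormedDual 𝕜 F) :=
  inferInstanceAs (NormedSpace 𝕜 (StrongDual 𝕜 F))

instance : CompleteSpace (NormedDual 𝕜 F) :=
  inferInstanceAs (CompleteSpace (StrongDual 𝕜 F))

instance : FunLike (NormedDual 𝕜 F) F 𝕜 :=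
  inferInstanceAs (FunLike (StrongDual 𝕜 F) F 𝕜)

instance : LinearMapClass (NormedDual 𝕜 F) 𝕜 F 𝕜 :=
  inferInstanceAs (LinearMapClass (StrongDual 𝕜 F) 𝕜 F 𝕜)

variable (𝕜 F) in
/-- The identity, as an isometric isomorphism from the dual. -/
noncomputable def ofStrongDual : StrongDual 𝕜 F ≃ₗᵢ[𝕜] NormedDual 𝕜 F :=
  LinearIsometryEquiv.refl 𝕜 (StrongDual 𝕜 F)

/-- A norm-continuous linear functional as an element of the dual. -/
def ofLinearMap (y : F →ₗ[𝕜] 𝕜) (hy : (UniformSpace.toTopologicalSpace : TopologicalSpace F) ≤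
    TopologicalSpace.induced y inferInstance) : NormedDual 𝕜 F :=
  ContinuousLinearMap.mk y (continuous_iff_le_induced.2 hy)

theorem norm_apply_le (y : NormedDual 𝕜 F) (x : F) : ‖y x‖ ≤ ‖y‖ * ‖x‖ :=
  ContinuousLinearMap.le_opNorm _ x

theorem norm_le_of_forall_le (y : NormedDual 𝕜 F) {C : ℝ} (hC : 0 ≤ C)
    (h : ∀ x, ‖y x‖ ≤ C * ‖x‖) : ‖y‖ ≤ C :=
  ContinuousLinearMap.opNorm_le_bound _ hC h

theorem norm_le_induced (y : NormedDual 𝕜 F) :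
    (UniformSpace.toTopologicalSpace : TopologicalSpace F) ≤
      TopologicalSpace.induced y inferInstance :=
  continuous_iff_le_induced.1 (ContinuousLinearMap.continuous _)

protected theorem ext {y z : NormedDual 𝕜 F} (h : ∀ f, y f = z f) : y = z :=
  DFunLike.ext _ _ h

/-- Evaluation of the functionals in a subspace of the dual. -/
noncomputable def eval (M : Submodule 𝕜 (NormedDual 𝕜 F)) : F →ₗ[𝕜] StrongDual 𝕜 M :=
  (((ofStrongDual 𝕜 F).symm : NormedDual 𝕜 F →L[𝕜] StrongDual 𝕜 F).comp
    M.subtypeL).flip.toLinearMap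

end NormedDual

section MixedPredual

variable {𝕜 : Type} [RCLike 𝕜] {F : Type v} [NormedAddCommGroup F] [NormedSpace 𝕜 F]

/-- The norm-continuous functionals that are continuous for the mixed topology. -/
def mixedDual (𝕜 : Type) [RCLike 𝕜] {F : Type v} [NormedAddCommGroup F] [NormedSpace 𝕜 F]
    (τ : TopologicalSpace F) : Submodule 𝕜 (NormedDual 𝕜 F) where
  carrier := {y | Continuous[mixedTopology 𝕜 τ, inferInstance] y}
  zero_mem' := @continuous_const _ _ (mixedTopology 𝕜 τ) _ 0
  add_mem' ha hb := @Continuous.add _ _ _ _ _ (mixedTopology 𝕜 τ) _ _ ha hb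
  smul_mem' c _ ha := @Continuous.const_smul _ _ _ _ _ _ (mixedTopology 𝕜 τ) _ ha c

/-- Adjoining to `τ` the initial topology of `y` gives a linear topology that `y` does not refine on
bounded sets. The mixed topology is finer still, so it makes `y` continuous. -/
theorem mem_mixedDual_of_continuousOn {τ : TopologicalSpace F} (hτ : IsPreSaksSpace 𝕜 τ)
    (y : NormedDual 𝕜 F)
    (hy : ∀ B : Set F, Bornology.IsBounded B → @ContinuousOn _ _ τ _ y B) :
    y ∈ mixedDual 𝕜 τ := by
  have hτc := (isLeast_mixedTopology 𝕜 τ hτ).1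
  have hw := @PolynormableSpace.withSeminorms 𝕜 F _ _ _ τ hτ.locallyConvex
  have h1 := hw.topologicalAddGroup
  have h2 := hw.continuousSMul
  let s : TopologicalSpace F := TopologicalSpace.induced y inferInstance
  have hc : IsMixedCandidate 𝕜 τ (τ ⊓ s) := by
    refine ⟨?_, ?_, inf_le_left, ?_, ?_⟩
    · exact continuousAdd_inf h1.toContinuousAdd (continuousAdd_induced y)
    · exact @continuousSMul_inf _ _ _ _ _ _ h2 (continuousSMul_induced y)
    · exact le_inf hτ.coarser_norm y.norm_le_induced
    · intro B hB
      rw [induced_inf, inf_eq_left, induced_compose, ← continuous_iff_le_induced]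
      exact @ContinuousOn.domRestrict _ _ τ _ _ _ (hy B hB)
  exact continuous_iff_le_induced.2
    (((isLeast_mixedTopology 𝕜 τ hτ).2 hc).trans inf_le_right)

theorem mem_mixedDual_of_continuous {τ : TopologicalSpace F} (hτ : IsPreSaksSpace 𝕜 τ)
    (y : NormedDual 𝕜 F) (hy : Continuous[τ, inferInstance] y) : y ∈ mixedDual 𝕜 τ :=
  mem_mixedDual_of_continuousOn hτ y fun _ _ => @Continuous.continuousOn _ _ τ _ _ _ hy

theorem continuousOn_of_mem_mixedDual {τ : TopologicalSpace F} (hτ : IsPreSaksSpace 𝕜 τ)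
    {y : NormedDual 𝕜 F} (hy : y ∈ mixedDual 𝕜 τ) {B : Set F} (hB : Bornology.IsBounded B) :
    @ContinuousOn _ _ τ _ y B := by
  rw [@continuousOn_iff_continuous_domRestrict _ _ τ]
  have h : Continuous[(mixedTopology 𝕜 τ).induced ((↑) : B → F), inferInstance]
      (B.domRestrict y) :=
    @ContinuousOn.domRestrict _ _ (mixedTopology 𝕜 τ) _ _ _
      (@Continuous.continuousOn _ _ (mixedTopology 𝕜 τ) _ _ _ hy)
  rwa [(isLeast_mixedTopology 𝕜 τ hτ).1.eq_on_bounded B hB] at h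

/-- Norm limits of functionals are uniform limits on bounded sets, and membership is tested by
`τ`-continuity there. -/
theorem isClosed_mixedDual {τ : TopologicalSpace F} (hτ : IsPreSaksSpace 𝕜 τ) :
    IsClosed (mixedDual 𝕜 τ : Set (NormedDual 𝕜 F)) := by
  refine isClosed_of_closure_subset fun y hy => mem_mixedDual_of_continuousOn hτ y fun B hB => ?_
  obtain ⟨C, hC, hBC⟩ := hB.exists_pos_norm_le
  refine @continuousOn_of_uniform_approx_of_continuousOn _ _ τ _ _ _ fun u hu => ?_
  obtain ⟨ε, hε, hεu⟩ := Metric.mem_uniformity_dist.1 hu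
  obtain ⟨z, hz, hyz⟩ := Metric.mem_closure_iff.1 hy (ε / C) (by positivity)
  refine ⟨z, continuousOn_of_mem_mixedDual hτ hz hB, fun x hx => hεu ?_⟩
  rw [dist_eq_norm] at hyz ⊢
  calc ‖y x - z x‖ = ‖(y - z) x‖ := rfl
    _ ≤ ‖y - z‖ * ‖x‖ := (y - z).norm_apply_le x
    _ ≤ ‖y - z‖ * C := by gcongr; exact hBC x hx
    _ < ε := (lt_div_iff₀ hC).1 hyz

/-- Evaluation of mixed-continuous functionals at the points of the space. -/
noncomputable def mixedEval (τ : TopologicalSpace F) (hτ : IsSaksSpace 𝕜 τ) :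
    F →ₗᵢ[𝕜] StrongDual 𝕜 (mixedDual 𝕜 τ) where
  toLinearMap := NormedDual.eval (mixedDual 𝕜 τ)
  norm_map' x := by
    refine le_antisymm ?_ ?_
    · refine ContinuousLinearMap.opNorm_le_bound _ (norm_nonneg x) fun y => ?_
      rw [mul_comm]
      exact (y : NormedDual 𝕜 F).norm_apply_le x
    · obtain ⟨Γ, -, hΓ, hsup⟩ := hτ.exists_seminorms
      refine (hsup x).2 ?_
      rintro _ ⟨q, hq, rfl⟩
      -- A functional norming `x` for `q` is `τ`-continuous, hence in the mixed dual, and lies in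
      -- the unit ball since `q ≤ ‖·‖`.
      obtain ⟨y, hyq, hyx⟩ := q.exists_linearMap_le_eq x
      have hy1 (z : F) : ‖y z‖ ≤ 1 * ‖z‖ := by
        rw [one_mul]
        exact (hyq z).trans ((hsup z).1 ⟨q, hq, rfl⟩)
      have hqc := hΓ.continuous_seminorm ⟨q, hq⟩
      have htg := hΓ.topologicalAddGroup
      have hyc := y.continuous_of_norm_le_seminorm hqc hyq
      let w : mixedDual 𝕜 τ :=
        ⟨.ofLinearMap y (hτ.coarser_norm.trans (continuous_iff_le_induced.1 hyc)),
          mem_mixedDual_of_continuous hτ.toIsPreSaksSpace _ hyc⟩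
      have hw : ‖w‖ ≤ 1 := NormedDual.norm_le_of_forall_le w.1 zero_le_one hy1
      refine le_trans ?_ (ContinuousLinearMap.unit_le_opNorm _ w hw)
      change q x ≤ ‖y x‖
      rw [hyx, RCLike.norm_ofReal]
      exact le_abs_self _

/-- Functionals on a subspace `M` of the dual that contains all pullbacks of continuous functionals
along a continuous linear map to a semi-reflexive space are given on these pullbacks by evaluation
at a point of that space. -/
theorem IsSemireflexive.exists_eval_eq {E : Type v} [AddCommGroup E] [Module 𝕜 E]
    [TopologicalSpace E] (hE : IsSemireflexive 𝕜 E) (i : F →ₗ[𝕜] E)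
    (hi : (UniformSpace.toTopologicalSpace : TopologicalSpace F) ≤
      TopologicalSpace.induced i inferInstance)
    (M : Submodule 𝕜 (NormedDual 𝕜 F))
    (hM : ∀ (w : NormedDual 𝕜 F) (y : E →ₗ[𝕜] 𝕜), Continuous y → (∀ x, w x = y (i x)) → w ∈ M)
    (Φ : StrongDual 𝕜 M) :
    ∃ x : E, ∀ (w : M) (y : E →ₗ[𝕜] 𝕜), Continuous y →
      (∀ x, (w : NormedDual 𝕜 F) x = y (i x)) → Φ w = y x := by
  let j : F →L[𝕜] E := ⟨i, continuous_iff_le_induced.2 hi⟩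
  -- Continuous for the strong topologies because `j` preserves boundedness; hence `Φ.comp r` is in
  -- the bidual of `E`.
  let r : StrongDual 𝕜 E →L[𝕜] M :=
    ((NormedDual.ofStrongDual 𝕜 F : StrongDual 𝕜 F →L[𝕜] NormedDual 𝕜 F).comp
      (ContinuousLinearMap.precomp 𝕜 j)).codRestrict M
      fun y => hM _ y.toLinearMap y.continuous fun _ => rfl
  obtain ⟨x, hx⟩ := hE (Φ.comp r)
  refine ⟨x, fun w y hy hw => ?_⟩
  have hr : r ⟨y, hy⟩ = w := Subtype.ext (NormedDual.ext fun x => (hw x).symm)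
  rw [← hr]
  exact hx ⟨y, hy⟩

/-- Semi-reflexivity is applied along the identity from the normed space `F` to `(F, γ)`. -/
theorem mixedEval_surjective {τ : TopologicalSpace F} (hτ : IsSemireflexiveSaksSpace 𝕜 τ) :
    Function.Surjective (mixedEval τ hτ.toIsSaksSpace) := by
  intro Φ
  obtain ⟨x, hx⟩ := @IsSemireflexive.exists_eval_eq 𝕜 _ F _ _ F _ _ (mixedTopology 𝕜 τ)
    hτ.semireflexive LinearMap.id
    ((isLeast_mixedTopology 𝕜 τ hτ.toIsPreSaksSpace).1.coarser_norm.trans_eq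
      (@induced_id F (mixedTopology 𝕜 τ)).symm)
    (mixedDual 𝕜 τ) (fun w y hy hw => by
      change Continuous[mixedTopology 𝕜 τ, inferInstance] w
      rwa [show ⇑w = y from funext hw]) Φ
  exact ⟨x, ContinuousLinearMap.ext fun w =>
    (hx w (LinearMapClass.linearMap (w : NormedDual 𝕜 F)) w.2 fun _ => rfl).symm⟩

/-- A semi-reflexive Saks space is the dual of its space of mixed-continuous functionals. -/
noncomputable def mixedPredualEquiv (τ : TopologicalSpace F)
    (hτ : IsSemireflexiveSaksSpace 𝕜 τ) :
    F ≃ₗᵢ[𝕜] StrongDual 𝕜 (mixedDual 𝕜 τ) :=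
  LinearIsometryEquiv.ofSurjective (mixedEval τ hτ.toIsSaksSpace) (mixedEval_surjective hτ)

end MixedPredual

section PredualEmbedding

variable {𝕜 F Z : Type*} [RCLike 𝕜] [NormedAddCommGroup F] [NormedSpace 𝕜 F]
  [NormedAddCommGroup Z] [NormedSpace 𝕜 Z]

/-- The isometric embedding of a predual into the dual. -/
noncomputable def predualEmbedding (ψ : F ≃ₗᵢ[𝕜] StrongDual 𝕜 Z) : Z →ₗᵢ[𝕜] NormedDual 𝕜 F :=
  (ψ.strongDualCongr.trans (NormedDual.ofStrongDual 𝕜 F)).toLinearIsometry.comp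
    (NormedSpace.inclusionInDoubleDualLi 𝕜)

theorem predualEmbedding_apply (ψ : F ≃ₗᵢ[𝕜] StrongDual 𝕜 Z) (z : Z) (f : F) :
    predualEmbedding ψ z f = ψ f z :=
  rfl

/-- If a separating set of functionals lies in a predual, the predual is its closed span. -/
theorem range_predualEmbedding [CompleteSpace Z] (ψ : F ≃ₗᵢ[𝕜] StrongDual 𝕜 Z)
    (S : Set (NormedDual 𝕜 F)) (hS : ∀ f : F, (∀ y ∈ S, y f = 0) → f = 0)
    (hSψ : ∀ y ∈ S, ∃ z, predualEmbedding ψ z = y) :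
    LinearMap.range (predualEmbedding ψ).toLinearMap =
      (Submodule.span 𝕜 S).topologicalClosure := by
  have hcl : IsClosed (LinearMap.range (predualEmbedding ψ).toLinearMap :
      Set (NormedDual 𝕜 F)) := by
    rw [LinearMap.coe_range]
    exact (predualEmbedding ψ).isometry.isClosedEmbedding.isClosed_range
  refine le_antisymm ?_ (Submodule.topologicalClosure_minimal _ (Submodule.span_le.2 hSψ) hcl)
  rw [LinearMap.range_eq_map, Submodule.map_le_iff_le_comap, top_le_iff]
  refine Submodule.eq_top_of_forall_dual_eq_zero _ ?_ fun g hg => ?_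
  · exact (Submodule.isClosed_topologicalClosure _).preimage (predualEmbedding ψ).continuous
  -- As `g = ψ f` for some `f`, vanishing of `g` on the span says that every functional in `S` kills
  -- `f`.
  · have h0 : ψ.symm g = 0 := by
      refine hS _ fun y hy => ?_
      obtain ⟨z, rfl⟩ := hSψ y hy
      rw [predualEmbedding_apply, ψ.apply_symm_apply]
      exact hg z (Submodule.le_topologicalClosure _ (Submodule.subset_span hy))
    simpa using h0

/-- A predual containing a separating set of functionals is isometric to its closed span. -/
noncomputable def predualEquivClosedSpan [CompleteSpace Z] (ψ : F ≃ₗᵢ[𝕜] StrongDual 𝕜 Z)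
    (S : Set (NormedDual 𝕜 F)) (hS : ∀ f : F, (∀ y ∈ S, y f = 0) → f = 0)
    (hSψ : ∀ y ∈ S, ∃ z, predualEmbedding ψ z = y) :
    Z ≃ₗᵢ[𝕜] (Submodule.span 𝕜 S).topologicalClosure :=
  (predualEmbedding ψ).equivRange.trans
    (LinearIsometryEquiv.ofEq _ _ (range_predualEmbedding ψ S hS hSψ))

end PredualEmbedding


theorem corollary5 {𝕜 : Type} [RCLike 𝕜] {Ω : Type*} [Nonempty Ω]
    {F : Type v} [FunLike F Ω 𝕜] [NormedAddCommGroup F] [NormedSpace 𝕜 F]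
    (coe_add : ∀ (f g : F) (x : Ω), (f + g) x = f x + g x)
    (coe_smul : ∀ (c : 𝕜) (f : F) (x : Ω), (c • f) x = c * f x)
    (τ : TopologicalSpace F) (hτ : IsSemireflexiveSaksSpace 𝕜 τ)
    (hp : τ ≤ TopologicalSpace.induced (fun (f : F) (x : Ω) => f x) Pi.topologicalSpace) :
    HasUniqueIsometricBanachPredual 𝕜 F ↔
      ∀ (Z : Type v) [NormedAddCommGroup Z] [NormedSpace 𝕜 Z] [CompleteSpace Z]
        (_φ : F ≃ₗᵢ[𝕜] StrongDual 𝕜 Z),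
        ∃ ψ : F ≃ₗᵢ[𝕜] StrongDual 𝕜 Z, ∀ x : Ω, ∃! z : Z, ∀ f : F, f x = ψ f z := by
  have hzero (f : F) (hf : ∀ x, f x = 0) : f = 0 :=
    DFunLike.ext _ _ fun x => by simpa [hf x] using (coe_smul 0 0 x).symm
  have hcancel {Z : Type v} [NormedAddCommGroup Z] [NormedSpace 𝕜 Z]
      (ψ : F ≃ₗᵢ[𝕜] StrongDual 𝕜 Z) {z w : Z} (h : ∀ f, ψ f z = ψ f w) : z = w :=
    (predualEmbedding ψ).injective (NormedDual.ext h)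
  have : CompleteSpace (mixedDual 𝕜 τ) :=
    (isClosed_mixedDual hτ.toIsPreSaksSpace).completeSpace_coe
  constructor
  · rintro ⟨-, huniq⟩ Z _ _ _ φ
    obtain ⟨e⟩ := huniq Z (mixedDual 𝕜 τ) φ (mixedPredualEquiv τ hτ)
    let ψ := (mixedPredualEquiv τ hτ).trans e.strongDualCongr
    refine ⟨ψ, fun x => ?_⟩
    let δ : F →ₗ[𝕜] 𝕜 :=
      { toFun f := f x, map_add' f g := coe_add f g x, map_smul' c f := coe_smul c f x }
    have hδ : Continuous[τ, inferInstance] δ :=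
      continuous_iff_le_induced.2 <| hp.trans <|
        (induced_mono (continuous_iff_le_induced.1 (continuous_apply x))).trans_eq induced_compose
    let y : mixedDual 𝕜 τ :=
      ⟨.ofLinearMap δ (hτ.coarser_norm.trans (continuous_iff_le_induced.1 hδ)),
        mem_mixedDual_of_continuous hτ.toIsPreSaksSpace _ hδ⟩
    have hy (f : F) : f x = ψ f (e.symm y) := by
      change f x = mixedEval τ hτ.toIsSaksSpace f (e (e.symm y))
      rw [e.apply_symm_apply]
      rfl
    exact ⟨e.symm y, hy, fun z hz => hcancel ψ fun f => (hz f).symm.trans (hy f)⟩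
  · intro h
    -- The point evaluations, chosen without reference to any predual: their closed span is the
    -- common model of all preduals.
    let S : Set (NormedDual 𝕜 F) := {y | ∃ x : Ω, ∀ f : F, y f = f x}
    have key (Z : Type v) [NormedAddCommGroup Z] [NormedSpace 𝕜 Z] [CompleteSpace Z]
        (φ : F ≃ₗᵢ[𝕜] StrongDual 𝕜 Z) :
        Nonempty (Z ≃ₗᵢ[𝕜] (Submodule.span 𝕜 S).topologicalClosure) := by
      obtain ⟨ψ, hψ⟩ := h Z φ
      choose z hz _ using hψ
      refine ⟨predualEquivClosedSpan ψ S (fun f hf => hzero f fun x => ?_) ?_⟩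
      · rw [hz x f]
        exact hf (predualEmbedding ψ (z x)) ⟨x, fun g => (hz x g).symm⟩
      · rintro y ⟨x, hx⟩
        exact ⟨z x, NormedDual.ext fun f => ((hx f).trans (hz x f)).symm⟩
    refine ⟨⟨mixedDual 𝕜 τ, inferInstance, inferInstance, this,
      ⟨mixedPredualEquiv τ hτ⟩⟩, fun Y _ _ _ Z _ _ _ φ ψ => ?_⟩
    obtain ⟨a⟩ := key Y φ
    obtain ⟨b⟩ := key Z ψ
    exact ⟨a.trans b.symm⟩
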